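/- Let $\log=\log_2$. For a positive integer $N$, a DRSample graph on the node set $[N]=\{1,\dots,N\}$ is the random directed acyclic graph $G_N$ with the edges $(v-1,v)$ for $2\le v\le N$ and an edge $(r(v),v)$ for $3\le v\le N$. Here the $r(v)$ are independent, and each is sampled as follows: choose an index $i$ uniformly from $\{1,\dots,\lfloor\log v\rfloor\}$, then choose $r(v)$ uniformly from the bucket $\{u\in[N] : 2^{i-1}<v-u\le 2^i\}$. For a finite directed acyclic graph $G=(V,E)$ write $\mathsf{parents}(W)=\{u : (u,w)\in E \text{ for some } w\in W\}$ for $W\subseteq V$, and let $\mathsf{sinks}(G)$ be the set of nodes without outgoing edges. A legal parallel quantum pebbling of $G$ is a sequence $P=(P_0,\dots,P_t)$ of subsets of $V$ with $P_0=\varnothing$ and $P_t=\mathsf{sinks}(G)$ such that, for each $1\le i\le t$, $\mathsf{parents}(P_i\setminus P_{i-1})\cup\mathsf{parents}(P_{i-1}\setminus P_i)\subseteq P_{i-1}\cap P_i$. Its space-time cost is $t\cdot\max_{1\le i\le t}|P_i|$. The parallel quantum space-time complexity $\Pi_{st}(G)$ is the minimum of this cost over all legal parallel quantum pebblings of $G$.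 Then with high probability $\Pi_{st}(G_N)=O\!\left(\frac{N^2\log\log N}{\log N}\right)$. Precisely: there is a constant $C>0$ such that for every $k\in\mathbb{N}$ and all sufficiently large $N$ (depending on $k$), $$\Pr\left[\Pi_{st}(G_N)\le C\,\frac{N^2\log\log N}{\log N}\right]\ \ge\ 1-\frac1{N^k}.$$ -/

import Mathlib

open Filter
open scoped ENNReal

noncomputable section

namespace QPebble

/-! ### The parallel quantum pebbling game on a directed graph -/

section Pebbling

variable {V : Type} [DecidableEq V]

/-- `parents(W, G)`: all tails of edges of `G` whose head lies in `W`. -/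
def parents (G : Digraph V) (W : Set V) : Set V := {u | ∃ w ∈ W, G.Adj u w}

/-- The nodes of `G` without outgoing edges. -/
def sinks (G : Digraph V) : Set V := {v | ∀ u, ¬ G.Adj v u}

/-- `(P 0, …, P t)` is a legal parallel quantum pebbling of `G` with target set `T`
(values `P i` with `i > t` play no role). -/
structure IsQuantumPebbling (G : Digraph V) (T : Set V) (t : ℕ) (P : ℕ → Finset V) : Prop where
  /-- No pebbles at the beginning. -/
  start : P 0 = ∅
  /-- The final configuration is exactly the target set. -/
  target : (P t : Set V) = T
  /-- A pebble is placed only if all parents were pebbled at the end of the previous round. -/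
  place : ∀ i < t, ∀ x ∈ P (i + 1) \ P i, parents G {x} ⊆ (P i : Set V)
  /-- A pebble is removed only if all parents were pebbled at the end of the previous round. -/
  remove : ∀ i < t, ∀ x ∈ P i \ P (i + 1), parents G {x} ⊆ (P i : Set V)
  /-- Pebbles used for placing or removing other pebbles are kept during the round. -/
  reversible : ∀ i < t,
    parents G (↑(P (i + 1) \ P i)) ∪ parents G (↑(P i \ P (i + 1))) ⊆ (P (i + 1) : Set V)

/-- Space of the pebbling `(P 0, …, P t)`: the maximum of `|P i|` over `1 ≤ i ≤ t`. -/
def space (t : ℕ) (P : ℕ → Finset V) : ℕ := (Finset.Icc 1 t).sup fun i => (P i).card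

/-- Parallel quantum space-time complexity of `G` with target set `T`: the minimum of
time times space over all legal parallel quantum pebblings (`⊤` if there is none). -/
def stComplexityTarget (G : Digraph V) (T : Set V) : ℕ∞ :=
  ⨅ (t : ℕ) (P : ℕ → Finset V) (_ : IsQuantumPebbling G T t P), ((t * space t P : ℕ) : ℕ∞)

/-- Parallel quantum space-time complexity of `G`, the target set being the sinks. -/
def stComplexity (G : Digraph V) : ℕ∞ := stComplexityTarget G (sinks G)

end Pebbling

/-! ### DRSample -/

/-- The node set `{1, …, N}`. -/
abbrev Node (N : ℕ) : Type := ↥(Finset.Icc 1 N)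

/-- The uniform distribution on `s`; the outcome is `none` if `s` is empty. -/
def uniformOrNone {α : Type} (s : Finset α) : PMF (Option α) :=
  open scoped Classical in
  if h : s.Nonempty then (PMF.uniformOfFinset s h).map some else PMF.pure none

/-- The bucket indices `1 ≤ i ≤ log₂ v`. -/
def bucketIndices (v : ℕ) : Finset ℕ := Finset.Icc 1 (Nat.log 2 v)

/-- The `i`-th bucket of `v`: the nodes `u ∈ {1, …, N}` with `2 ^ (i - 1) < v - u ≤ 2 ^ i`,
the difference being taken in the integers. -/
def bucket {N : ℕ} (v : Node N) (i : ℕ) : Finset (Node N) :=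
  Finset.univ.filter fun u =>
    (2 : ℤ) ^ (i - 1) < (v : ℤ) - (u : ℤ) ∧ (v : ℤ) - (u : ℤ) ≤ (2 : ℤ) ^ i

/-- Law of the random predecessor `r(v)`: a uniform bucket index, then a uniform node of that
bucket. Only `v = 1` (no bucket index) and `v = 2` (its only bucket is empty) have
no random predecessor. -/
def predecessorLaw {N : ℕ} (v : Node N) : PMF (Option (Node N)) :=
  (uniformOrNone (bucketIndices v)).bind fun o =>
    match o with
    | none => PMF.pure none
    | some i => uniformOrNone (bucket v i)

/-- The law of independent random variables with laws `p i`. -/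
def productLaw {ι α : Type} [Fintype ι] [DecidableEq ι] [Fintype α] (p : ι → PMF α) :
    PMF (ι → α) :=
  PMF.ofFintype (fun ω => ∏ i, p i (ω i)) <| by
    rw [← Fintype.prod_sum]
    refine Finset.prod_eq_one fun i _ => ?_
    simpa only [tsum_fintype] using (p i).tsum_coe

/-- The graph on `{1, …, N}` with the edges `(v - 1, v)` and `(r(v), v)`. -/
def graphOf {N : ℕ} (r : Node N → Option (Node N)) : Digraph (Node N) where
  Adj u v := (u : ℕ) + 1 = v ∨ r v = some u

/-- The DRSample distribution on graphs with node set `{1, …, N}`: the predecessors `r(v)`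
are independent. -/
def drSample (N : ℕ) : PMF (Digraph (Node N)) :=
  (productLaw fun v : Node N => predecessorLaw v).map graphOf

end QPebble

end

/-!
A legal round can be undone by a legal round, so pebblings are walks in an undirected graph of
configurations. Cut the nodes into blocks of `A` consecutive ones and pebble block by block, keeping
after each block only the tails of edges into later blocks: fill the next block in one node at a
time, then remove what is not kept by running backwards the filling that starts from the kept
pebbles. This takes at most `2 * A` rounds per block, hence `O(N)` rounds with at most `A` pebbles
besides the kept ones.

If `v` lies at least `2 ^ a` steps into its block, then `r(v)` lies in an earlier block only if one
of the buckets `i > a` was chosen, which has probability at most `1 - a / log v`. This bounds the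
expected number of random edges that cross blocks, and Hoeffding's inequality bounds the deviation.
With `n = log N` and `l = log n`, the choice `A = 2 ^ (n - l)` and `a = n - 2 * l` makes the number
of pebbles `O(N * l / n)`.
-/

namespace QPebble

open scoped Finset

section Configurations

variable {V : Type} {G : Digraph V} {s n : ℕ}

/-- The configurations of pebbles, two of them being adjacent if they have at most `s` pebbles and
one legal round leads from one to the other. Legal rounds are reversible, so this graph is
undirected, and a pebbling with at most `s` pebbles is a walk in it. -/
def configGraph (G : Digraph V) (s : ℕ) : SimpleGraph (Finset V) where
  Adj P Q := P ≠ Q ∧ parents G (symmDiff (P : Set V) Q) ⊆ (P : Set V) ∩ Q ∧ #P ≤ s ∧ #Q ≤ s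
  symm := ⟨fun _ _ h =>
    ⟨h.1.symm, by rw [symmDiff_comm, Set.inter_comm]; exact h.2.1, h.2.2.symm⟩⟩
  loopless := ⟨fun _ h => h.1 rfl⟩

theorem configGraph_edist_le_one {P Q : Finset V}
    (h : ∀ ⦃u v⦄, G.Adj u v → ¬(v ∈ P ↔ v ∈ Q) → u ∈ P ∧ u ∈ Q) (hP : #P ≤ s) (hQ : #Q ≤ s) :
    (configGraph G s).edist P Q ≤ 1 := by
  rw [SimpleGraph.edist_le_one_iff_adj_or_eq, or_iff_not_imp_right]
  refine fun hne => ⟨hne, ?_, hP, hQ⟩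
  rintro u ⟨v, hv, huv⟩
  refine h huv ?_
  rw [Set.mem_symmDiff] at hv
  grind

variable [DecidableEq V]

theorem configGraph_edist_union_right_le (P Q W : Finset V) :
    (configGraph G (s + #W)).edist (P ∪ W) (Q ∪ W) ≤ (configGraph G s).edist P Q := by
  refine le_iInf fun w => ?_
  induction w with
  | nil => simp
  | @cons P P' Q h w ih =>
    have hcard {R : Finset V} (hR : #R ≤ s) : #(R ∪ W) ≤ s + #W :=
      (Finset.card_union_le _ _).trans (by lia)
    have hstep : (configGraph G (s + #W)).edist (P ∪ W) (P' ∪ W) ≤ 1 := by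
      refine configGraph_edist_le_one (fun u v huv hv => ?_)
        (hcard h.2.2.1) (hcard h.2.2.2)
      have hu : u ∈ (P : Set V) ∩ P' := h.2.1 ⟨v, by rw [Set.mem_symmDiff]; grind, huv⟩
      exact ⟨Finset.mem_union_left _ hu.1, Finset.mem_union_left _ hu.2⟩
    calc _ ≤ _ := SimpleGraph.edist_triangle
      _ ≤ 1 + (w.length : ℕ∞) := add_le_add hstep ih
      _ = _ := by rw [SimpleGraph.Walk.length_cons, Nat.cast_succ, add_comm]

theorem isQuantumPebbling_getVert {X : Finset V} (w : (configGraph G s).Walk ∅ X) :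
    IsQuantumPebbling G X w.length w.getVert := by
  have hround {i : ℕ} (hi : i < w.length) {x : V}
      (hx : ¬(x ∈ w.getVert i ↔ x ∈ w.getVert (i + 1))) :
      parents G {x} ⊆ w.getVert i ∩ w.getVert (i + 1) := by
    rintro u ⟨_, rfl, hu⟩
    exact (w.adj_getVert_succ hi).2.1 ⟨_, by rw [Set.mem_symmDiff]; grind, hu⟩
  refine ⟨w.getVert_zero, by rw [w.getVert_length], fun i hi x hx => ?_, fun i hi x hx => ?_, ?_⟩
  · exact fun u hu => (hround hi (by grind) hu).1
  · exact fun u hu => (hround hi (by grind) hu).1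
  · rintro i hi u (⟨x, hx, hu⟩ | ⟨x, hx, hu⟩) <;>
      exact (hround hi (by grind) ⟨x, rfl, hu⟩).2

theorem stComplexityTarget_le_of_edist_le {X : Finset V}
    (h : (configGraph G s).edist ∅ X ≤ n) : stComplexityTarget G X ≤ (n * s : ℕ) := by
  obtain ⟨w, hw⟩ := SimpleGraph.exists_walk_of_edist_ne_top
    (ne_top_of_le_ne_top (ENat.natCast_ne_top n) h)
  have hlength : w.length ≤ n := by exact_mod_cast hw.trans_le h
  have hspace : space w.length w.getVert ≤ s := by
    refine Finset.sup_le fun i hi => ?_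
    obtain ⟨j, rfl⟩ : ∃ j, i = j + 1 := ⟨i - 1, by grind⟩
    exact (w.adj_getVert_succ (Nat.lt_of_succ_le (Finset.mem_Icc.mp hi).2)).2.2.2
  refine (iInf₂_le_of_le w.length w.getVert (iInf_le _ (isQuantumPebbling_getVert w))).trans ?_
  exact_mod_cast Nat.mul_le_mul hlength hspace

/-- Compute a configuration containing the parents of `z`, pebble `z`, and uncompute. -/
theorem stComplexityTarget_singleton_le_of_edist_le {X : Finset V} {z : V}
    (h : (configGraph G s).edist ∅ X ≤ n) (hX : #X ≤ s) (hz : ∀ u, G.Adj u z → u ∈ X) :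
    stComplexityTarget G {z} ≤ ((2 * n + 1) * (s + 1) : ℕ) := by
  rw [← Finset.coe_singleton]
  refine stComplexityTarget_le_of_edist_le ?_
  have hcompute : (configGraph G (s + 1)).edist ∅ X ≤ n := by
    refine (SimpleGraph.edist_anti fun P Q hPQ => ?_).trans h
    exact ⟨hPQ.1, hPQ.2.1, hPQ.2.2.1.trans s.le_succ, hPQ.2.2.2.trans s.le_succ⟩
  have hplace : (configGraph G (s + 1)).edist X (X ∪ {z}) ≤ 1 := by
    refine configGraph_edist_le_one (fun u v huv hv => ?_) (hX.trans s.le_succ)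
      ((Finset.card_union_le _ _).trans (by simpa using hX))
    have hvz : v = z := by grind
    exact ⟨hz u (hvz ▸ huv), Finset.mem_union_left _ (hz u (hvz ▸ huv))⟩
  have huncompute : (configGraph G (s + 1)).edist (X ∪ {z}) {z} ≤ n := by
    rw [SimpleGraph.edist_comm]
    simpa using (configGraph_edist_union_right_le ∅ X {z}).trans h
  calc _ ≤ (n : ℕ∞) + (1 + n) := SimpleGraph.edist_triangle.trans <|
        add_le_add hcompute (SimpleGraph.edist_triangle.trans (add_le_add hplace huncompute))
    _ = (2 * n + 1 : ℕ) := by push_cast; ring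

end Configurations

section Blocks

variable {V : Type} [Fintype V] {G : Digraph V} {level : V → ℕ} {A q s : ℕ}

/-- The nodes `v` with `a ≤ level v < b`. -/
def levelIco (level : V → ℕ) (a b : ℕ) : Finset V := {v | level v ∈ Finset.Ico a b}

theorem mem_levelIco {a b : ℕ} {v : V} : v ∈ levelIco level a b ↔ a ≤ level v ∧ level v < b := by
  simp [levelIco]

theorem configGraph_edist_union_levelIco_le [DecidableEq V]
    (hG : ∀ ⦃u v⦄, G.Adj u v → level u < level v) {X : Finset V} {a : ℕ} (j : ℕ)
    (hX : ∀ ⦃u v⦄, G.Adj u v → level u < a → v ∈ levelIco level a (a + j) → u ∈ X)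
    (hs : #(X ∪ levelIco level a (a + j)) ≤ s) :
    (configGraph G s).edist X (X ∪ levelIco level a (a + j)) ≤ j := by
  induction j with
  | zero => simp [levelIco]
  | succ j ih =>
    have hmono : levelIco level a (a + j) ⊆ levelIco level a (a + (j + 1)) := fun v hv => by
      rw [mem_levelIco] at hv ⊢
      lia
    have hunion := Finset.union_subset_union_right (s := X) hmono
    have hfill := ih (fun u v huv hu hv => hX huv hu (hmono hv))
      ((Finset.card_le_card hunion).trans hs)
    have hnext : (configGraph G s).edist (X ∪ levelIco level a (a + j))
        (X ∪ levelIco level a (a + (j + 1))) ≤ 1 := by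
      refine configGraph_edist_le_one (fun u v huv hv => ?_)
        ((Finset.card_le_card hunion).trans hs) hs
      have hlevel : level v = a + j := by
        simp only [Finset.mem_union, mem_levelIco] at hv
        grind
      have hu : u ∈ X ∪ levelIco level a (a + j) := by
        rcases lt_or_ge (level u) a with hua | hua
        · exact Finset.mem_union_left _ (hX huv hua (mem_levelIco.mpr (by lia)))
        · exact Finset.mem_union_right _ (mem_levelIco.mpr ⟨hua, hlevel ▸ hG huv⟩)
      exact ⟨hu, hunion hu⟩
    exact_mod_cast SimpleGraph.edist_triangle.trans (add_le_add hfill hnext)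

open scoped Classical in
/-- The tails of the edges between different blocks of `A` consecutive levels, the levels
`A * q, …, A * q + A - 1` forming block `q`. -/
noncomputable def crossingTails (G : Digraph V) (level : V → ℕ) (A : ℕ) : Finset V :=
  {u | ∃ v, G.Adj u v ∧ level u / A < level v / A}

theorem mem_crossingTails {u : V} :
    u ∈ crossingTails G level A ↔ ∃ v, G.Adj u v ∧ level u / A < level v / A := by
  simp [crossingTails]

/-- The pebbles that the block-by-block pebbling keeps after finishing the blocks before `q`. -/
noncomputable def retained (G : Digraph V) (level : V → ℕ) (A q : ℕ) : Finset V :=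
  {u ∈ crossingTails G level A | level u < A * q}

theorem mem_retained_of_adj {u v : V} (hA : 0 < A) (huv : G.Adj u v) (hu : level u < A * q)
    (hv : A * q ≤ level v) : u ∈ retained G level A q := by
  have hcross : level u / A < level v / A :=
    (Nat.div_lt_of_lt_mul hu).trans_le ((Nat.le_div_iff_mul_le hA).mpr (mul_comm A q ▸ hv))
  exact Finset.mem_filter.mpr ⟨mem_crossingTails.mpr ⟨v, huv, hcross⟩, hu⟩

theorem retained_succ_union_levelIco [DecidableEq V] :
    retained G level A (q + 1) ∪ levelIco level (A * q) (A * q + A) =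
      retained G level A q ∪ levelIco level (A * q) (A * q + A) := by
  ext u
  simp only [retained, Finset.mem_union, Finset.mem_filter, mem_levelIco, mul_add_one]
  grind

variable {B : ℕ}

theorem card_retained_union_levelIco_le [DecidableEq V]
    (hB : ∀ q, #(levelIco level (A * q) (A * q + A)) ≤ B) {b : ℕ} (hb : b ≤ A * q + A) :
    #(retained G level A q ∪ levelIco level (A * q) b) ≤ #(crossingTails G level A) + B := by
  refine (Finset.card_union_le _ _).trans (add_le_add ?_ ((Finset.card_le_card ?_).trans (hB q)))
  · exact Finset.card_le_card (Finset.filter_subset _ _)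
  · intro v hv
    rw [mem_levelIco] at hv ⊢
    exact ⟨hv.1, hv.2.trans_le hb⟩

variable (hG : ∀ ⦃u v⦄, G.Adj u v → level u < level v) (hA : 0 < A)
  (hB : ∀ q, #(levelIco level (A * q) (A * q + A)) ≤ B)
include hG hA hB

/-- Both the start `retained q` and the end `retained (q + 1)` become the same configuration when
block `q` is filled in, so a block is cleared by filling it in backwards. -/
theorem configGraph_edist_retained_succ_le (q : ℕ) :
    (configGraph G (#(crossingTails G level A) + B)).edist (retained G level A q)
      (retained G level A (q + 1)) ≤ (2 * A : ℕ) := by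
  classical
  have hfill := configGraph_edist_union_levelIco_le hG (X := retained G level A q) (a := A * q) A
    (fun u v huv hu hv => mem_retained_of_adj hA huv hu (mem_levelIco.mp hv).1)
    (card_retained_union_levelIco_le hB le_rfl)
  have hmono : retained G level A q ⊆ retained G level A (q + 1) :=
    Finset.monotone_filter_right _ fun u _ hu => hu.trans_le (Nat.mul_le_mul_left A q.le_succ)
  have hclear := configGraph_edist_union_levelIco_le hG
    (X := retained G level A (q + 1)) (a := A * q) (s := #(crossingTails G level A) + B) A
    (fun u v huv hu hv => hmono (mem_retained_of_adj hA huv hu (mem_levelIco.mp hv).1))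
    (by rw [retained_succ_union_levelIco]; exact card_retained_union_levelIco_le hB le_rfl)
  rw [retained_succ_union_levelIco, SimpleGraph.edist_comm] at hclear
  calc _ ≤ (A + A : ℕ∞) := SimpleGraph.edist_triangle.trans (add_le_add hfill hclear)
    _ = (2 * A : ℕ) := by push_cast; ring

theorem configGraph_edist_empty_retained_le (q : ℕ) :
    (configGraph G (#(crossingTails G level A) + B)).edist ∅ (retained G level A q) ≤
      (2 * A * q : ℕ) := by
  induction q with
  | zero => simp [retained]
  | succ q ih =>
    exact_mod_cast SimpleGraph.edist_triangle.trans
      (add_le_add ih (configGraph_edist_retained_succ_le hG hA hB q))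

theorem stComplexityTarget_singleton_le_card_crossingTails [DecidableEq V] (z : V) :
    stComplexityTarget G {z} ≤
      ((4 * level z + 1) * (#(crossingTails G level A) + B + 1) : ℕ) := by
  set q := level z / A
  obtain ⟨j, hj⟩ : ∃ j, level z = A * q + j := Nat.exists_eq_add_of_le (Nat.mul_div_le _ _)
  have hjA : j < A := by
    have := Nat.lt_mul_div_succ (level z) hA
    lia
  have hparents (u : V) (hu : G.Adj u z) :
      u ∈ retained G level A q ∪ levelIco level (A * q) (A * q + j) := by
    rcases lt_or_ge (level u) (A * q) with h | h
    · exact Finset.mem_union_left _ (mem_retained_of_adj hA hu h (by lia))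
    · exact Finset.mem_union_right _ (mem_levelIco.mpr ⟨h, hj ▸ hG hu⟩)
  have hcard := card_retained_union_levelIco_le (G := G) hB (q := q) (b := A * q + j) (by lia)
  have hfill := configGraph_edist_union_levelIco_le hG (X := retained G level A q) (a := A * q) j
    (fun u v huv hu hv => mem_retained_of_adj hA huv hu (mem_levelIco.mp hv).1) hcard
  have hdist : (configGraph G (#(crossingTails G level A) + B)).edist ∅
      (retained G level A q ∪ levelIco level (A * q) (A * q + j)) ≤ (2 * level z : ℕ) := by
    refine (SimpleGraph.edist_triangle.trans
      (add_le_add (configGraph_edist_empty_retained_le hG hA hB q) hfill)).trans ?_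
    rw [hj]
    exact_mod_cast (by lia : 2 * A * q + j ≤ 2 * (A * q + j))
  exact_mod_cast (stComplexityTarget_singleton_le_of_edist_le hdist hcard hparents).trans_eq
    (by ring_nf)

end Blocks

section Probability

open MeasureTheory ProbabilityTheory

theorem measureReal_pi_sum_add_le_ncard_le_exp {ι : Type*} [Fintype ι] {Ω : ι → Type*}
    [∀ i, MeasurableSpace (Ω i)] (μ : ∀ i, Measure (Ω i)) [∀ i, IsProbabilityMeasure (μ i)]
    {s : ∀ i, Set (Ω i)} (hs : ∀ i, MeasurableSet (s i)) {ε : ℝ} (hε : 0 ≤ ε) :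
    (Measure.pi μ).real {ω | ∑ i, (μ i).real (s i) + ε ≤ {i | ω i ∈ s i}.ncard} ≤
      Real.exp (-2 * ε ^ 2 / Fintype.card ι) := by
  classical
  let X (i : ι) (x : Ω i) : ℝ := (s i).indicator 1 x - (μ i).real (s i)
  have hX (i : ι) : AEMeasurable (X i) (μ i) :=
    ((measurable_one.indicator (hs i)).sub_const _).aemeasurable
  have hsub (i : ι) : HasSubgaussianMGF (X i) ((‖(1 : ℝ) - 0‖₊ / 2) ^ 2) (μ i) := by
    have h01 (x : Ω i) : (s i).indicator (1 : Ω i → ℝ) x ∈ Set.Icc 0 1 :=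
      ⟨Set.indicator_nonneg (fun _ _ => zero_le_one) x,
        Set.indicator_le' (fun _ _ => le_rfl) (fun _ _ => zero_le_one) x⟩
    simpa only [integral_indicator_one (hs i)] using
      hasSubgaussianMGF_of_mem_Icc (measurable_one.indicator (hs i)).aemeasurable
        (ae_of_all (μ i) h01)
  have hsub_pi (i : ι) : HasSubgaussianMGF (fun ω : ∀ i, Ω i => X i (ω i))
      ((‖(1 : ℝ) - 0‖₊ / 2) ^ 2) (Measure.pi μ) :=
    .of_map (measurable_pi_apply i).aemeasurable <| by
      rw [(measurePreserving_eval μ i).map_eq]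
      exact hsub i
  have hsum (ω : ∀ i, Ω i) :
      ∑ i, X i (ω i) = {i | ω i ∈ s i}.ncard - ∑ i, (μ i).real (s i) := by
    simp [X, Set.indicator_apply, Set.ncard_eq_toFinset_card']
  have htail := HasSubgaussianMGF.measure_sum_ge_le_of_iIndepFun (iIndepFun_pi hX)
    (s := Finset.univ) (fun i _ => hsub_pi i) hε
  simp only [hsum, le_sub_iff_add_le'] at htail
  refine htail.trans_eq (congrArg Real.exp ?_)
  simp only [sub_zero, nnnorm_one, one_div, inv_pow, Finset.sum_const, Finset.card_univ,
    nsmul_eq_mul, NNReal.coe_mul, NNReal.coe_natCast, NNReal.coe_inv, NNReal.coe_pow,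
    NNReal.coe_ofNat, neg_mul]
  ring_nf

theorem toMeasure_productLaw {ι α : Type} [Fintype ι] [DecidableEq ι] [Fintype α]
    [MeasurableSpace α] [MeasurableSingletonClass α] (p : ι → PMF α) :
    (productLaw p).toMeasure = Measure.pi fun i => (p i).toMeasure := by
  refine Measure.ext_of_singleton fun ω => ?_
  rw [PMF.toMeasure_apply_singleton _ _ (measurableSet_singleton ω), Measure.pi_singleton]
  simp only [PMF.toMeasure_apply_singleton _ _ (measurableSet_singleton _)]
  rfl

theorem one_sub_exp_le_productLaw_ncard_lt {ι α : Type} [Fintype ι] [DecidableEq ι] [Fintype α]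
    (p : ι → PMF α) (s : ι → Set α) {ε : ℝ} (hε : 0 ≤ ε) :
    1 - Real.exp (-2 * ε ^ 2 / Fintype.card ι) ≤
      ((productLaw p).toOuterMeasure {ω | ({i | ω i ∈ s i}.ncard : ℝ) <
        ∑ i, ((p i).toOuterMeasure (s i)).toReal + ε}).toReal := by
  let : MeasurableSpace α := ⊤
  have htail := measureReal_pi_sum_add_le_ncard_le_exp (fun i => (p i).toMeasure)
    (fun i => MeasurableSet.of_discrete (s := s i)) hε
  rw [← toMeasure_productLaw] at htail
  have hcompl := probReal_compl_eq_one_sub (μ := (productLaw p).toMeasure)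
    (MeasurableSet.of_discrete
      (s := {ω | ∑ i, (p i).toMeasure.real (s i) + ε ≤ {i | ω i ∈ s i}.ncard}))
  simp only [Set.compl_ofPred, not_le, measureReal_def, PMF.toMeasure_apply_eq_toOuterMeasure]
    at hcompl htail
  rw [hcompl]
  exact sub_le_sub_left htail 1

end Probability

section Predecessors

theorem toOuterMeasure_le_one {α : Type*} (p : PMF α) (s : Set α) : p.toOuterMeasure s ≤ 1 := by
  let : MeasurableSpace α := ⊤
  rw [← p.toMeasure_apply_eq_toOuterMeasure]
  exact MeasureTheory.prob_le_one

theorem toOuterMeasure_ne_top {α : Type*} (p : PMF α) (s : Set α) : p.toOuterMeasure s ≠ ⊤ :=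
  ne_top_of_le_ne_top ENNReal.one_ne_top (toOuterMeasure_le_one p s)

theorem toReal_toOuterMeasure_le_one {α : Type*} (p : PMF α) (s : Set α) :
    (p.toOuterMeasure s).toReal ≤ 1 :=
  ENNReal.toReal_le_of_le_ofReal zero_le_one <| by
    simpa only [ENNReal.ofReal_one] using toOuterMeasure_le_one p s

theorem toReal_toOuterMeasure_mono {α : Type*} (p : PMF α) {s t : Set α}
    (h : s ∩ p.support ⊆ t) : (p.toOuterMeasure s).toReal ≤ (p.toOuterMeasure t).toReal :=
  ENNReal.toReal_mono (toOuterMeasure_ne_top p t) (p.toOuterMeasure_mono h)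

theorem some_mem_support_uniformOrNone {α : Type} {s : Finset α} {x : α} :
    some x ∈ (uniformOrNone s).support ↔ x ∈ s := by
  unfold uniformOrNone
  split_ifs with h
  · simp
  · simp [Finset.not_nonempty_iff_eq_empty.mp h]

variable {N : ℕ}

theorem mem_bucket {u v : Node N} {i : ℕ} :
    u ∈ bucket v i ↔ (u : ℕ) + 2 ^ (i - 1) < v ∧ (v : ℕ) ≤ u + 2 ^ i := by
  simp only [bucket, Finset.mem_filter_univ]
  zify
  rw [lt_sub_iff_add_lt', sub_le_iff_le_add']

theorem lt_of_some_mem_support_predecessorLaw {u v : Node N}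
    (h : some u ∈ (predecessorLaw v).support) : (u : ℕ) < v := by
  obtain ⟨_ | i, -, hu⟩ := (PMF.mem_support_bind_iff _ _ _).mp h
  · simp at hu
  · exact (Nat.le_add_right _ _).trans_lt (mem_bucket.mp (some_mem_support_uniformOrNone.mp hu)).1

theorem toReal_predecessorLaw_eq_average {v : Node N} (hv : Nat.log 2 v ≠ 0)
    (E : Set (Option (Node N))) :
    ((predecessorLaw v).toOuterMeasure E).toReal =
      (∑ i ∈ bucketIndices v, ((uniformOrNone (bucket v i)).toOuterMeasure E).toReal) /
        Nat.log 2 v := by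
  have hne : (bucketIndices v).Nonempty := Finset.nonempty_Icc.mpr (Nat.one_le_iff_ne_zero.mpr hv)
  have hlaw : predecessorLaw v = (PMF.uniformOfFinset (bucketIndices v) hne).bind
      fun i => uniformOrNone (bucket v i) := by
    rw [predecessorLaw, uniformOrNone, dif_pos hne, PMF.bind_map]
    rfl
  have hcard : (bucketIndices v).card = Nat.log 2 v := by simp [bucketIndices]
  rw [hlaw, PMF.toOuterMeasure_bind_apply, tsum_eq_sum (s := bucketIndices v) fun i hi => by
      rw [PMF.uniformOfFinset_apply_of_notMem _ hi, zero_mul],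
    ENNReal.toReal_sum fun i _ => ENNReal.mul_ne_top (PMF.apply_ne_top _ _)
      (toOuterMeasure_ne_top _ _), Finset.sum_div]
  refine Finset.sum_congr rfl fun i hi => ?_
  rw [PMF.uniformOfFinset_apply_of_mem _ hi, hcard, ENNReal.toReal_mul, ENNReal.toReal_inv,
    ENNReal.toReal_natCast, inv_mul_eq_div]

/-- The outcomes of `r(v)` for which the edge `(r(v), v)` comes from an earlier block than that of
`v`, the nodes `A * q, …, A * q + A - 1` forming block `q`. -/
def earlierBlocks (A : ℕ) (v : Node N) : Set (Option (Node N)) :=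
  {o | ∃ u : Node N, o = some u ∧ (u : ℕ) / A < (v : ℕ) / A}

theorem uniformOrNone_bucket_earlierBlocks_eq_zero {A i : ℕ} {v : Node N}
    (hi : 2 ^ i ≤ (v : ℕ) % A) :
    (uniformOrNone (bucket v i)).toOuterMeasure (earlierBlocks A v) = 0 := by
  rw [PMF.toOuterMeasure_apply_eq_zero_iff, Set.disjoint_left]
  rintro _ hu ⟨u, rfl, hlt⟩
  have hvu := (mem_bucket.mp (some_mem_support_uniformOrNone.mp hu)).2
  have hblock : A * (v / A) ≤ u := by
    have := Nat.div_add_mod (v : ℕ) A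
    lia
  rcases A.eq_zero_or_pos with rfl | hA
  · simp at hlt
  exact hlt.not_ge ((Nat.le_div_iff_mul_le hA).mpr (mul_comm A _ ▸ hblock))

theorem predecessorLaw_earlierBlocks_le {A a : ℕ} {v : Node N} (ha : 2 ^ a ≤ (v : ℕ) % A) :
    ((predecessorLaw v).toOuterMeasure (earlierBlocks A v)).toReal ≤ 1 - a / Nat.log 2 v := by
  have hav : a ≤ Nat.log 2 v := Nat.le_log_of_pow_le one_lt_two (ha.trans (Nat.mod_le _ _))
  rcases eq_or_ne (Nat.log 2 v) 0 with hv | hv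
  · simpa only [hv, Nat.cast_zero, div_zero, sub_zero] using toReal_toOuterMeasure_le_one _ _
  have hlog : (Nat.log 2 v : ℝ) ≠ 0 := by exact_mod_cast hv
  have hbucket (i : ℕ) : ((uniformOrNone (bucket v i)).toOuterMeasure (earlierBlocks A v)).toReal ≤
      if a < i then 1 else 0 := by
    split_ifs with hi
    · exact toReal_toOuterMeasure_le_one _ _
    · rw [uniformOrNone_bucket_earlierBlocks_eq_zero
        ((Nat.pow_le_pow_right two_pos (not_lt.mp hi)).trans ha), ENNReal.toReal_zero]
  have hcount : {i ∈ bucketIndices v | a < i} = Finset.Ioc a (Nat.log 2 v) := by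
    ext i
    simp only [bucketIndices, Finset.mem_filter, Finset.mem_Icc, Finset.mem_Ioc]
    lia
  calc ((predecessorLaw v).toOuterMeasure (earlierBlocks A v)).toReal
      ≤ (∑ i ∈ bucketIndices v, if a < i then 1 else 0) / Nat.log 2 v := by
        rw [toReal_predecessorLaw_eq_average hv]
        gcongr with i
        exact hbucket i
    _ = 1 - a / Nat.log 2 v := by
        rw [Finset.sum_boole, hcount, Nat.card_Ioc, Nat.cast_sub hav, sub_div, div_self hlog]

theorem card_node_mod_lt_le (A L : ℕ) :
    #{v : Node N | (v : ℕ) % A < L} ≤ L * (N / A + 1) := by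
  calc #{v : Node N | (v : ℕ) % A < L}
      ≤ (Finset.range L ×ˢ Finset.range (N / A + 1)).card := by
        refine Finset.card_le_card_of_injOn (fun v => ((v : ℕ) % A, (v : ℕ) / A)) (fun v hv => ?_)
          fun v _ w _ h => Subtype.ext ?_
        · have hdiv : (v : ℕ) / A ≤ N / A := Nat.div_le_div_right (Finset.mem_Icc.mp v.2).2
          simp_all
        · obtain ⟨hmod, hdiv⟩ := Prod.mk.inj h
          rw [← Nat.div_add_mod (v : ℕ) A, hmod, hdiv, Nat.div_add_mod]
    _ = L * (N / A + 1) := by simp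

theorem sum_predecessorLaw_earlierBlocks_le {A a : ℕ} (ha : a ≤ Nat.log 2 N) :
    ∑ v : Node N, ((predecessorLaw v).toOuterMeasure (earlierBlocks A v)).toReal ≤
      2 ^ a * (N / A + 1 : ℕ) + N * (1 - a / Nat.log 2 N) := by
  have hfrac : (a : ℝ) / Nat.log 2 N ≤ 1 := div_le_one_of_le₀ (by exact_mod_cast ha) (by positivity)
  have hnode (v : Node N) : ((predecessorLaw v).toOuterMeasure (earlierBlocks A v)).toReal ≤
      (if (v : ℕ) % A < 2 ^ a then 1 else 0) + (1 - a / Nat.log 2 N : ℝ) := by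
    split_ifs with hv
    · linarith [toReal_toOuterMeasure_le_one (predecessorLaw v) (earlierBlocks A v)]
    · rw [zero_add]
      refine (predecessorLaw_earlierBlocks_le (not_lt.mp hv)).trans (sub_le_sub_left ?_ 1)
      rcases a.eq_zero_or_pos with rfl | ha0
      · simp
      have hav : a ≤ Nat.log 2 v :=
        Nat.le_log_of_pow_le one_lt_two ((not_lt.mp hv).trans (Nat.mod_le _ _))
      have hlog_pos : 0 < Nat.log 2 v := ha0.trans_le hav
      gcongr
      exact (Finset.mem_Icc.mp v.2).2
  calc _ ≤ ∑ v : Node N, ((if (v : ℕ) % A < 2 ^ a then 1 else 0) + (1 - a / Nat.log 2 N : ℝ)) :=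
        Finset.sum_le_sum fun v _ => hnode v
    _ = #{v : Node N | (v : ℕ) % A < 2 ^ a} +
        N * (1 - a / Nat.log 2 N : ℝ) := by
        simp [Finset.sum_add_distrib, -Finset.univ_eq_attach, mul_one_sub]
    _ ≤ _ := by
        gcongr
        exact_mod_cast card_node_mod_lt_le A (2 ^ a)

end Predecessors

section Graph

variable {N : ℕ} {r : Node N → Option (Node N)}

theorem lt_of_graphOf_adj (hr : ∀ ⦃v u⦄, r v = some u → (u : ℕ) < v) {u v : Node N}
    (h : (graphOf r).Adj u v) : (u : ℕ) < v :=
  h.elim (fun h => h ▸ Nat.lt_succ_self _) fun h => hr h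

theorem sinks_graphOf (hr : ∀ ⦃v u⦄, r v = some u → (u : ℕ) < v) (hN : N ∈ Finset.Icc 1 N) :
    sinks (graphOf r) = {⟨N, hN⟩} := by
  ext v
  have hv := Finset.mem_Icc.mp v.2
  refine ⟨fun h => ?_, ?_⟩
  · by_contra hne
    have hvN : (v : ℕ) ≠ N := fun h => hne (Subtype.ext h)
    exact h ⟨v + 1, Finset.mem_Icc.mpr (by lia)⟩ (Or.inl rfl)
  · rintro rfl u hu
    exact (lt_of_graphOf_adj hr hu).not_ge (Finset.mem_Icc.mp u.2).2

theorem card_levelIco_node_le (a b : ℕ) :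
    #(levelIco (Subtype.val : Node N → ℕ) a b) ≤ b - a := by
  rw [← Nat.card_Ico]
  exact Finset.card_le_card_of_injOn Subtype.val
    (fun v hv => Finset.mem_coe.mpr (Finset.mem_Ico.mpr (mem_levelIco.mp hv)))
    Subtype.val_injective.injOn

theorem card_crossingTails_graphOf_le (r : Node N → Option (Node N)) (A : ℕ) :
    #(crossingTails (graphOf r) Subtype.val A) ≤
      N / A + {v | r v ∈ earlierBlocks A v}.ncard := by
  classical
  let S : Finset (Node N) := {u | (u : ℕ) < N ∧ A ∣ u + 1}
  let F : Finset (Node N) := {v | r v ∈ earlierBlocks A v}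
  have hsubset : crossingTails (graphOf r) Subtype.val A ⊆ S ∪ (F.image r).eraseNone := by
    intro u hu
    obtain ⟨v, huv | hrv, hlt⟩ := mem_crossingTails.mp hu
    · refine Finset.mem_union_left _ ((Finset.mem_filter_univ _).mpr ⟨?_, ?_⟩)
      · exact Nat.lt_of_succ_le (huv.trans_le (Finset.mem_Icc.mp v.2).2)
      · by_contra hdvd
        exact hlt.ne (huv ▸ (Nat.succ_div_of_not_dvd hdvd).symm)
    · refine Finset.mem_union_right _ (Finset.mem_eraseNone.mpr (Finset.mem_image.mpr ⟨v, ?_, hrv⟩))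
      exact (Finset.mem_filter_univ _).mpr ⟨u, hrv, hlt⟩
  have hS : #S ≤ N / A := by
    rw [← Nat.card_multiples]
    refine Finset.card_le_card_of_injOn Subtype.val (fun u hu => ?_) Subtype.val_injective.injOn
    simpa [S] using hu
  have hF : #(F.image r).eraseNone ≤ {v | r v ∈ earlierBlocks A v}.ncard := by
    rw [Set.ncard_eq_toFinset_card', Set.toFinset_ofPred]
    exact (Finset.card_eraseNone_le _).trans Finset.card_image_le
  exact (Finset.card_le_card hsubset).trans ((Finset.card_union_le _ _).trans (add_le_add hS hF))

theorem stComplexity_graphOf_le (hr : ∀ ⦃v u⦄, r v = some u → (u : ℕ) < v) (hN : 0 < N) {A : ℕ}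
    (hA : 0 < A) :
    stComplexity (graphOf r) ≤
      ((4 * N + 1) * (N / A + {v | r v ∈ earlierBlocks A v}.ncard + A + 1) : ℕ) := by
  rw [stComplexity, sinks_graphOf hr (Finset.mem_Icc.mpr ⟨hN, le_rfl⟩)]
  refine (stComplexityTarget_singleton_le_card_crossingTails (level := Subtype.val)
    (fun _ _ => lt_of_graphOf_adj hr) hA (B := A) (fun q => ?_) _).trans ?_
  · exact (card_levelIco_node_le _ _).trans_eq (Nat.add_sub_cancel_left _ _)
  · gcongr
    exact card_crossingTails_graphOf_le r A

end Graph

section Tradeoff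

theorem mem_support_productLaw {ι α : Type} [Fintype ι] [DecidableEq ι] [Fintype α]
    {p : ι → PMF α} {ω : ι → α} :
    ω ∈ (productLaw p).support ↔ ∀ i, ω i ∈ (p i).support := by
  have happly : productLaw p ω = ∏ i, p i (ω i) := rfl
  simp only [PMF.mem_support_iff, happly, Finset.prod_ne_zero_iff, Finset.mem_univ, true_imp_iff]

theorem one_sub_exp_le_drSample_stComplexity_le {N A a : ℕ} (hN : 0 < N) (hA : 0 < A)
    (ha : a ≤ Nat.log 2 N) {ε : ℝ} (hε : 0 ≤ ε) :
    1 - Real.exp (-2 * ε ^ 2 / N) ≤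
      ((drSample N).toOuterMeasure
        {G | (stComplexity G : ℝ≥0∞) ≤
          ENNReal.ofReal ((4 * N + 1) *
            ((2 ^ a + 1) * (N / A + 1 : ℕ) + N * (1 - a / Nat.log 2 N) + A + ε))}).toReal := by
  have hhoeffding := one_sub_exp_le_productLaw_ncard_lt (fun v : Node N => predecessorLaw v)
    (earlierBlocks A) hε
  rw [Fintype.card_coe, Nat.card_Icc, Nat.add_sub_cancel] at hhoeffding
  rw [drSample, PMF.toOuterMeasure_map_apply]
  refine hhoeffding.trans (toReal_toOuterMeasure_mono _ ?_)
  rintro r ⟨hcount, hsupport⟩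
  have hr ⦃v u : Node N⦄ (hv : r v = some u) : (u : ℕ) < v :=
    lt_of_some_mem_support_predecessorLaw (hv ▸ mem_support_productLaw.mp hsupport v)
  have hcross : ({v | r v ∈ earlierBlocks A v}.ncard : ℝ) ≤
      2 ^ a * (N / A + 1 : ℕ) + N * (1 - a / Nat.log 2 N) + ε :=
    (hcount.trans_le (by gcongr; exact sum_predecessorLaw_earlierBlocks_le ha)).le
  have hcost : (stComplexity (graphOf r) : ℝ≥0∞) ≤
      ((4 * N + 1) * (N / A + {v | r v ∈ earlierBlocks A v}.ncard + A + 1) : ℕ) := by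
    exact_mod_cast ENat.toENNReal_le.mpr (stComplexity_graphOf_le hr hN hA)
  refine hcost.trans ?_
  rw [← ENNReal.ofReal_natCast]
  refine ENNReal.ofReal_le_ofReal ?_
  push_cast at hcross ⊢
  refine mul_le_mul_of_nonneg_left ?_ (by positivity)
  linarith

end Tradeoff

section Parameters

theorem two_mul_log_two_le (n : ℕ) : 2 * Nat.log 2 n ≤ n := by
  rcases eq_or_ne n 0 with rfl | hn
  · simp
  have hpow := Nat.pow_log_le_self 2 hn
  rcases (Nat.log 2 n).eq_zero_or_eq_succ_pred with hl | hl
  · simp [hl]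
  · have hlt := Nat.lt_two_pow_self (n := (Nat.log 2 n).pred)
    rw [hl, pow_succ] at hpow
    lia

variable {N n l : ℕ}

theorem div_two_pow_sub_add_one_le (hN : N < 2 ^ (n + 1)) (hl : l ≤ n) :
    N / 2 ^ (n - l) + 1 ≤ 2 ^ (l + 1) := by
  refine Nat.succ_le_of_lt (Nat.div_lt_of_lt_mul (hN.trans_eq ?_))
  rw [← pow_add]
  congr 1
  lia

theorem two_pow_add_one_mul_div_le (hN : N < 2 ^ (n + 1)) (hl : 2 * l ≤ n) :
    (2 ^ (n - 2 * l) + 1) * (N / 2 ^ (n - l) + 1) ≤ 4 * 2 ^ (n - l) := by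
  have hsplit : 2 ^ (n - 2 * l) * 2 ^ l = 2 ^ (n - l) := by
    rw [← pow_add]
    congr 1
    lia
  have hmono : 2 ^ l ≤ 2 ^ (n - l) := Nat.pow_le_pow_right two_pos (by lia)
  calc (2 ^ (n - 2 * l) + 1) * (N / 2 ^ (n - l) + 1)
      ≤ (2 ^ (n - 2 * l) + 1) * 2 ^ (l + 1) := by
        gcongr
        exact div_two_pow_sub_add_one_le hN (by lia)
    _ = 2 * 2 ^ (n - l) + 2 * 2 ^ l := by rw [pow_succ, ← hsplit]; ring
    _ ≤ 4 * 2 ^ (n - l) := by lia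

theorem two_pow_sub_mul_le (hN : 2 ^ n ≤ N) (hn : n < 2 ^ (l + 1)) (hl : l ≤ n) :
    2 ^ (n - l) * n ≤ 2 * N := by
  calc 2 ^ (n - l) * n ≤ 2 ^ (n - l) * 2 ^ (l + 1) := Nat.mul_le_mul_left _ hn.le
    _ = 2 * 2 ^ n := by
      rw [← pow_add, ← pow_succ']
      congr 1
      lia
    _ ≤ 2 * N := Nat.mul_le_mul_left 2 hN

theorem mul_log_log_div_log_le (hN : 2 ≤ N) :
    (N * Nat.log 2 (Nat.log 2 N) / Nat.log 2 N : ℝ) ≤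
      2 * (N * Real.logb 2 (Real.logb 2 N) / Real.logb 2 N) := by
  have hlog : 1 ≤ Nat.log 2 N := Nat.le_log_of_pow_le one_lt_two (by lia)
  have hlog_pos : (0 : ℝ) < Nat.log 2 N := by exact_mod_cast hlog
  have hlog_le : (Nat.log 2 N : ℝ) ≤ Real.logb 2 N := mod_cast Real.natLog_le_logb N 2
  have hlogb_le : Real.logb 2 N ≤ 2 * Nat.log 2 N := by
    have hlt : (N : ℝ) ≤ 2 ^ (2 * Nat.log 2 N) := by
      exact_mod_cast (Nat.lt_pow_succ_log_self one_lt_two N).le.trans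
        (Nat.pow_le_pow_right two_pos (by lia))
    rw [Real.logb_le_iff_le_rpow one_lt_two (by positivity)]
    exact_mod_cast hlt
  have hloglog_le : (Nat.log 2 (Nat.log 2 N) : ℝ) ≤ Real.logb 2 (Real.logb 2 N) :=
    (mod_cast Real.natLog_le_logb (Nat.log 2 N) 2 : _ ≤ Real.logb 2 (Nat.log 2 N)).trans
      (Real.logb_le_logb_of_le one_lt_two hlog_pos hlog_le)
  rw [mul_div_assoc', div_le_div_iff₀ hlog_pos (hlog_pos.trans_le hlog_le)]
  calc (N : ℝ) * Nat.log 2 (Nat.log 2 N) * Real.logb 2 N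
      ≤ N * Real.logb 2 (Real.logb 2 N) * (2 * Nat.log 2 N) := by
        gcongr
        · exact (hlog_pos.trans_le hlog_le).le
        · exact mul_nonneg N.cast_nonneg (hloglog_le.trans' (Nat.cast_nonneg _))
    _ = 2 * (N * Real.logb 2 (Real.logb 2 N)) * Nat.log 2 N := by ring

theorem blockwise_cost_le (hN : 4 ≤ N) (hn : Nat.log 2 N = n) (hl : Nat.log 2 n = l) :
    (4 * N + 1) * ((2 ^ (n - 2 * l) + 1) * (N / 2 ^ (n - l) + 1 : ℕ) +
      N * (1 - (n - 2 * l : ℕ) / n) + (2 ^ (n - l) : ℕ) + N / n) ≤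
      (130 : ℝ) * (N ^ 2 * Real.logb 2 (Real.logb 2 N) / Real.logb 2 N) := by
  have hn2 : 2 ≤ n := hn ▸ Nat.le_log_of_pow_le one_lt_two hN
  have hl1 : 1 ≤ l := hl ▸ Nat.le_log_of_pow_le one_lt_two hn2
  have hln : 2 * l ≤ n := hl ▸ two_mul_log_two_le n
  have hn0 : (0 : ℝ) < n := by positivity
  have hblocks : ((2 ^ (n - 2 * l) + 1) * (N / 2 ^ (n - l) + 1 : ℕ) : ℝ) ≤
      4 * (2 ^ (n - l) : ℕ) := by
    exact_mod_cast two_pow_add_one_mul_div_le (hn ▸ Nat.lt_pow_succ_log_self one_lt_two N) hln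
  have hlength : ((2 ^ (n - l) : ℕ) : ℝ) ≤ 2 * (N / n) := by
    rw [mul_div_assoc', le_div_iff₀ hn0]
    exact_mod_cast two_pow_sub_mul_le (hn ▸ Nat.pow_log_le_self 2 (by lia))
      (hl ▸ Nat.lt_pow_succ_log_self one_lt_two n) (by lia)
  have hcrossing : (N * (1 - (n - 2 * l : ℕ) / n) : ℝ) = 2 * (N * l / n) := by
    rw [Nat.cast_sub hln]
    push_cast
    field_simp
    ring
  have hfrac : (N / n : ℝ) ≤ N * l / n := by
    gcongr
    exact le_mul_of_one_le_right N.cast_nonneg (by exact_mod_cast hl1)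
  have hlogb := mul_log_log_div_log_le (N := N) (by lia)
  rw [hn, hl] at hlogb
  have hN1 : (1 : ℝ) ≤ N := by exact_mod_cast (by lia : 1 ≤ N)
  calc _ ≤ (5 * N) * (13 * (N * l / n : ℝ)) := by
        rw [hcrossing]
        exact mul_le_mul (by linarith) (by linarith) (by positivity) (by positivity)
    _ ≤ (5 * N) * (13 * (2 * (N * Real.logb 2 (Real.logb 2 N) / Real.logb 2 N))) := by gcongr
    _ = _ := by ring

theorem eventually_exp_neg_le_one_div_pow (k : ℕ) :
    ∀ᶠ N : ℕ in atTop, Real.exp (-2 * (N / Nat.log 2 N) ^ 2 / N) ≤ 1 / (N : ℝ) ^ k := by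
  have hlittleO := (Real.isLittleO_pow_log_id_atTop (n := 3)).bound
    (show (0 : ℝ) < 1 / (2 * (k + 1)) by positivity)
  filter_upwards [tendsto_natCast_atTop_atTop.eventually hlittleO, eventually_ge_atTop 2]
    with N hN hN2
  have hN0 : (0 : ℝ) < N := by positivity
  have hlogN : 0 < Real.log N := Real.log_pos (by exact_mod_cast hN2)
  have hn0 : (0 : ℝ) < Nat.log 2 N := by
    exact_mod_cast Nat.log_pos one_lt_two hN2
  have hn_le : (Nat.log 2 N : ℝ) ≤ 2 * Real.log N := by
    have hlogb : (Nat.log 2 N : ℝ) ≤ Real.log N / Real.log 2 :=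
      mod_cast Real.natLog_le_logb N 2
    rw [le_div_iff₀ (Real.log_pos one_lt_two)] at hlogb
    nlinarith [Real.log_two_gt_d9]
  have hpow : k * Real.log N * (2 * Real.log N) ^ 2 ≤ 2 * N := by
    rw [id, Real.norm_of_nonneg (by positivity), Real.norm_of_nonneg hN0.le, div_mul_eq_mul_div,
      one_mul, le_div_iff₀ (by positivity)] at hN
    nlinarith [pow_pos hlogN 3]
  have hexponent : k * Real.log N ≤ 2 * (N / Nat.log 2 N) ^ 2 / N := by
    calc k * Real.log N ≤ 2 * N / Nat.log 2 N ^ 2 := by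
          rw [le_div_iff₀ (by positivity)]
          exact hpow.trans' (by gcongr)
      _ = 2 * (N / Nat.log 2 N) ^ 2 / N := by field_simp
  calc Real.exp (-2 * (N / Nat.log 2 N) ^ 2 / N) ≤ Real.exp (-(k * Real.log N)) := by
        rw [neg_mul, neg_div]
        gcongr
    _ = 1 / (N : ℝ) ^ k := by
        rw [Real.exp_neg, Real.exp_nat_mul, Real.exp_log hN0, one_div]

end Parameters

end QPebble

theorem mainTheorem5 :
    ∃ C : ℝ, 0 < C ∧ ∀ k : ℕ, ∀ᶠ N : ℕ in atTop,
      1 - 1 / (N : ℝ) ^ k ≤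
        ((QPebble.drSample N).toOuterMeasure
          {G | (QPebble.stComplexity G : ℝ≥0∞) ≤
            ENNReal.ofReal
              (C * ((N : ℝ) ^ 2 * Real.logb 2 (Real.logb 2 N) / Real.logb 2 N))}).toReal := by
  refine ⟨130, by norm_num, fun k => ?_⟩
  filter_upwards [QPebble.eventually_exp_neg_le_one_div_pow k, eventually_ge_atTop 4] with N hexp hN
  set n := Nat.log 2 N
  set l := Nat.log 2 n
  have htradeoff := QPebble.one_sub_exp_le_drSample_stComplexity_le (N := N) (A := 2 ^ (n - l))
    (a := n - 2 * l) (ε := N / n) (by lia) (by positivity) (by lia) (by positivity)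
  refine (sub_le_sub_left hexp 1).trans (htradeoff.trans ?_)
  refine QPebble.toReal_toOuterMeasure_mono _ fun G hG => ?_
  exact hG.1.trans (ENNReal.ofReal_le_ofReal (QPebble.blockwise_cost_le hN rfl rfl))
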